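/- All algebras below are residuated lattices $(A,\wedge,\vee,\cdot,\backslash,/,1)$, i.e. lattices with a monoid structure such that $xy\le z\iff y\le x\backslash z\iff x\le z/y$. Homomorphisms, embeddings and varieties are those of this signature. A chain is a totally ordered residuated lattice. A residuated lattice is integral if $1$ is its top element, and semilinear if it is a subdirect product of chains. A variety is semilinear, or has the congruence extension property (CEP), if all its members are semilinear, respectively have the CEP. A V-formation $(\mathbf A,\mathbf B,\mathbf C,i,j)$ consists of algebras and embeddings $i:\mathbf A\to\mathbf B$, $j:\mathbf A\to\mathbf C$. A one-amalgam of it is $(\mathbf D,h,k)$ with $h:\mathbf B\to\mathbf D$ a homomorphism and $k:\mathbf C\to\mathbf D$ an embedding such that $h\circ i=k\circ j$; it is an amalgam if $h$ is also an embedding. A variety $\mathsf V$ has the amalgamation property (AP) if each V-formation in $\mathsf V$ has an amalgam in $\mathsf V$. Let $\mathbf A,\mathbf B,\mathbf C$ be the following finite commutative integral chains, where $x\to y=x\backslash y=y/x$ is the residual of the product: - $\mathbf A=\{u<v<1\}$ with $v^2=v$, $uv=u^2=u$; - $\mathbf B=\{u<b<v<1\}$ with $v^2=v$, $vb=b$,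 $b^2=u$, and $ux=u$ for all $x$; - $\mathbf C=\{u<d<c<v<1\}$ with $v^2=v$, $vc=vd=d$, $c^2=cd=d^2=u$, and $ux=u$ for all $x$. $\mathbf A$ is a subalgebra of $\mathbf B$ and of $\mathbf C$. A nucleus on a residuated lattice is a closure operator $\delta$ with $\delta(x)\delta(y)\le\delta(xy)$. For an integral residuated lattice $\mathbf M$ with a nucleus $\delta$ and $n\ge2$, the generalized $n$-rotation $\mathbf M^\delta_n$ is the residuated lattice on the disjoint union of $M$, $\{\ell_i:0<i<n-1\}$ and a copy $\{b':b\in\delta[M]\}$ of $\delta[M]$, with unit the $1$ of $\mathbf M$. Its order is that of $\mathbf M$ on $M$, $\ell_1<\dots<\ell_{n-2}$ on the $\ell_i$, and the dual order on the copy ($a'\le b'\iff b\le a$), with every $b'$ below every $\ell_i$ and every element of $M$, and every $\ell_i$ below every element of $M$. Put $0=1'$, the bottom element. The product extends that of $\mathbf M$, and for $a\in M$, $b,c\in\delta[M]$, $$a\,b'=(b/a)',\quad b'a=(a\backslash b)',\quad a\ell_i=\ell_i a=\ell_i,\quad b'c'=b'\ell_i=\ell_i b'=0,$$ $$\ell_i\ell_j=\ell_{i+j-(n-1)}\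 \text{if } i+j\ge n,\qquad \ell_i\ell_j=0\ \text{otherwise};$$ the divisions are the residuals of this product. **Theorem.** Let $n\ge 2$, and let $\delta$ be a nucleus on the algebras above, that is, nuclei $\delta_A,\delta_B,\delta_C$ on $\mathbf A,\mathbf B,\mathbf C$ such that $\delta_B$ and $\delta_C$ both restrict to $\delta_A$ on $A$. Let $\mathcal{VS}^\delta$ consist of $\mathbf A^{\delta}_n,\mathbf B^{\delta}_n,\mathbf C^{\delta}_n$ and the inclusions of the first algebra in the other two. Then: 1. $\mathcal{VS}^\delta$ is a V-formation; 2. there is neither an amalgam nor a one-amalgam $(\mathbf D,h,k)$ of $\mathcal{VS}^\delta$ in which $\mathbf D$ is a chain; 3. if $\mathsf V$ is a variety of semilinear residuated lattices with the CEP that contains $\mathbf A^{\delta}_n,\mathbf B^{\delta}_n,\mathbf C^{\delta}_n$, then $\mathsf V$ does not have the AP. -/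

import Mathlib

universe u

/-! ### Residuated lattices -/

/-- A residuated lattice `(A, ∧, ∨, ·, \, /, 1)`; `ldiv x z` is `x \ z` and `rdiv z y` is `z / y`. -/
class ResiduatedLattice (α : Type*) extends Lattice α, Monoid α where
  ldiv : α → α → α
  rdiv : α → α → α
  le_ldiv_iff : ∀ x y z : α, y ≤ ldiv x z ↔ x * y ≤ z
  le_rdiv_iff : ∀ x y z : α, x ≤ rdiv z y ↔ x * y ≤ z

/-- A residuated lattice is integral when its unit is the top element. -/
class IsIntegralRL (α : Type*) [ResiduatedLattice α] : Prop where
  le_unit : ∀ x : α, x ≤ 1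

/-- A chain: a totally ordered residuated lattice. -/
def IsRLChain (α : Type*) [ResiduatedLattice α] : Prop := ∀ x y : α, x ≤ y ∨ y ≤ x

/-- Homomorphisms of residuated lattices. -/
structure IsRLHom {α β : Type*} [ResiduatedLattice α] [ResiduatedLattice β] (f : α → β) :
    Prop where
  map_inf : ∀ x y, f (x ⊓ y) = f x ⊓ f y
  map_sup : ∀ x y, f (x ⊔ y) = f x ⊔ f y
  map_mul : ∀ x y, f (x * y) = f x * f y
  map_ldiv : ∀ x y, f (ResiduatedLattice.ldiv x y) = ResiduatedLattice.ldiv (f x) (f y)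
  map_rdiv : ∀ x y, f (ResiduatedLattice.rdiv x y) = ResiduatedLattice.rdiv (f x) (f y)
  map_one : f 1 = 1

/-- Embeddings of residuated lattices: injective homomorphisms. -/
structure IsRLEmbedding {α β : Type*} [ResiduatedLattice α] [ResiduatedLattice β] (f : α → β) :
    Prop extends IsRLHom f where
  injective : Function.Injective f

/-- A residuated lattice is semilinear when it is (isomorphic to) a subdirect product of chains. -/
def IsSemilinear (α : Type u) [ResiduatedLattice α] : Prop :=
  ∃ (ι : Type u) (F : ι → Type u) (_ : ∀ i, ResiduatedLattice (F i)) (f : ∀ i, α → F i),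
    (∀ i, IsRLChain (F i)) ∧ (∀ i, IsRLHom (f i) ∧ Function.Surjective (f i)) ∧
      Function.Injective (fun (x : α) (i : ι) => f i x)

/-! ### Subalgebras, congruences and the congruence extension property -/

/-- Subalgebras of a residuated lattice. -/
structure RLSubalgebra (α : Type*) [ResiduatedLattice α] where
  carrier : Set α
  inf_mem : ∀ {x y}, x ∈ carrier → y ∈ carrier → x ⊓ y ∈ carrier
  sup_mem : ∀ {x y}, x ∈ carrier → y ∈ carrier → x ⊔ y ∈ carrier
  mul_mem : ∀ {x y}, x ∈ carrier → y ∈ carrier → x * y ∈ carrier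
  ldiv_mem : ∀ {x y}, x ∈ carrier → y ∈ carrier → ResiduatedLattice.ldiv x y ∈ carrier
  rdiv_mem : ∀ {x y}, x ∈ carrier → y ∈ carrier → ResiduatedLattice.rdiv x y ∈ carrier
  one_mem : (1 : α) ∈ carrier

/-- A subalgebra, with the restricted operations, is a residuated lattice. -/
instance RLSubalgebra.instResiduatedLattice {α : Type*} [ResiduatedLattice α]
    (S : RLSubalgebra α) : ResiduatedLattice S.carrier where
  toPartialOrder := Subtype.partialOrder _
  inf x y := ⟨x ⊓ y, S.inf_mem x.2 y.2⟩
  inf_le_left x y := inf_le_left (a := (x : α))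
  inf_le_right x y := inf_le_right (a := (x : α))
  le_inf x y z h h' := le_inf (show (x : α) ≤ y from h) (show (x : α) ≤ z from h')
  sup x y := ⟨x ⊔ y, S.sup_mem x.2 y.2⟩
  le_sup_left x y := le_sup_left (a := (x : α))
  le_sup_right x y := le_sup_right (a := (x : α))
  sup_le x y z h h' := sup_le (show (x : α) ≤ z from h) (show (y : α) ≤ z from h')
  mul x y := ⟨x * y, S.mul_mem x.2 y.2⟩
  one := ⟨1, S.one_mem⟩
  mul_assoc x y z := Subtype.ext (mul_assoc (x : α) y z)
  one_mul x := Subtype.ext (one_mul (x : α))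
  mul_one x := Subtype.ext (mul_one (x : α))
  ldiv x y := ⟨ResiduatedLattice.ldiv x y, S.ldiv_mem x.2 y.2⟩
  rdiv x y := ⟨ResiduatedLattice.rdiv x y, S.rdiv_mem x.2 y.2⟩
  le_ldiv_iff x y z := ResiduatedLattice.le_ldiv_iff (x : α) y z
  le_rdiv_iff x y z := ResiduatedLattice.le_rdiv_iff (x : α) y z

/-- Congruences of a residuated lattice. -/
structure RLCongruence (α : Type*) [ResiduatedLattice α] extends Setoid α where
  inf_compat : ∀ {x x' y y'}, r x x' → r y y' → r (x ⊓ y) (x' ⊓ y')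
  sup_compat : ∀ {x x' y y'}, r x x' → r y y' → r (x ⊔ y) (x' ⊔ y')
  mul_compat : ∀ {x x' y y'}, r x x' → r y y' → r (x * y) (x' * y')
  ldiv_compat : ∀ {x x' y y'}, r x x' → r y y' →
    r (ResiduatedLattice.ldiv x y) (ResiduatedLattice.ldiv x' y')
  rdiv_compat : ∀ {x x' y y'}, r x x' → r y y' →
    r (ResiduatedLattice.rdiv x y) (ResiduatedLattice.rdiv x' y')

/-- The congruence extension property of a single algebra: every congruence of every subalgebra is
the restriction of a congruence of the whole algebra. -/
def HasCEP (α : Type*) [ResiduatedLattice α] : Prop :=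
  ∀ (S : RLSubalgebra α) (Θ : RLCongruence S.carrier),
    ∃ Φ : RLCongruence α, ∀ x y : S.carrier, Φ.r (x : α) (y : α) ↔ Θ.r x y

/-! ### Varieties -/

/-- Terms in the language of residuated lattices over countably many variables. -/
inductive RLTerm : Type
  | var (k : ℕ)
  | one
  | inf (s t : RLTerm)
  | sup (s t : RLTerm)
  | mul (s t : RLTerm)
  | ldiv (s t : RLTerm)
  | rdiv (s t : RLTerm)

/-- The value of a term under an assignment of its variables. -/
def RLTerm.eval {α : Type*} [ResiduatedLattice α] (v : ℕ → α) : RLTerm → α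
  | var k => v k
  | one => 1
  | inf s t => s.eval v ⊓ t.eval v
  | sup s t => s.eval v ⊔ t.eval v
  | mul s t => s.eval v * t.eval v
  | ldiv s t => ResiduatedLattice.ldiv (s.eval v) (t.eval v)
  | rdiv s t => ResiduatedLattice.rdiv (s.eval v) (t.eval v)

/-- A variety of residuated lattices, presented by a set of equations: its members are the
residuated lattices that satisfy all of them. -/
structure RLVariety where
  equations : Set (RLTerm × RLTerm)

/-- Membership of a residuated lattice in a variety. -/
def RLVariety.Mem (V : RLVariety) (α : Type*) [ResiduatedLattice α] : Prop :=
  ∀ e ∈ V.equations, ∀ v : ℕ → α, e.1.eval v = e.2.eval v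

/-- All members (in the universe `u`) are semilinear. -/
def RLVariety.Semilinear (V : RLVariety) : Prop :=
  ∀ (α : Type u) [ResiduatedLattice α], V.Mem α → IsSemilinear α

/-- All members (in the universe `u`) have the congruence extension property. -/
def RLVariety.CEP (V : RLVariety) : Prop :=
  ∀ (α : Type u) [ResiduatedLattice α], V.Mem α → HasCEP α

/-! ### Amalgamation -/

/-- `i : A → B` and `j : A → C` form a V-formation. -/
def IsVFormation {A B C : Type*} [ResiduatedLattice A] [ResiduatedLattice B]
    [ResiduatedLattice C] (i : A → B) (j : A → C) : Prop :=
  IsRLEmbedding i ∧ IsRLEmbedding j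

/-- `(D, h, k)` is an amalgam of the V-formation `(A, B, C, i, j)`. -/
def IsAmalgam {A B C D : Type*} [ResiduatedLattice B] [ResiduatedLattice C] [ResiduatedLattice D]
    (i : A → B) (j : A → C) (h : B → D) (k : C → D) : Prop :=
  IsRLEmbedding h ∧ IsRLEmbedding k ∧ h ∘ i = k ∘ j

/-- `(D, h, k)` is a one-amalgam of the V-formation `(A, B, C, i, j)`: only `k : C → D` has to be
injective. -/
def IsOneAmalgam {A B C D : Type*} [ResiduatedLattice B] [ResiduatedLattice C]
    [ResiduatedLattice D] (i : A → B) (j : A → C) (h : B → D) (k : C → D) : Prop :=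
  IsRLHom h ∧ IsRLEmbedding k ∧ h ∘ i = k ∘ j

/-- The amalgamation property (in the universe `u`). -/
def RLVariety.AP (V : RLVariety) : Prop :=
  ∀ (A B C : Type u) [ResiduatedLattice A] [ResiduatedLattice B] [ResiduatedLattice C],
    V.Mem A → V.Mem B → V.Mem C →
    ∀ (i : A → B) (j : A → C), IsVFormation i j →
      ∃ (D : Type u) (_ : ResiduatedLattice D), V.Mem D ∧
        ∃ (h : B → D) (k : C → D), IsAmalgam i j h k

/-! ### Nuclei -/

/-- A nucleus on a residuated lattice: a closure operator `δ` with `δ x * δ y ≤ δ (x * y)`. -/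
structure RLNucleus (α : Type*) [ResiduatedLattice α] extends ClosureOperator α where
  mul_le' : ∀ x y, toFun x * toFun y ≤ toFun (x * y)

instance (α : Type*) [ResiduatedLattice α] : CoeFun (RLNucleus α) (fun _ => α → α) :=
  ⟨fun δ => δ.toClosureOperator⟩

namespace ResiduatedLattice

variable {α : Type*} [ResiduatedLattice α]

theorem mul_mono {a b c d : α} (h : a ≤ b) (h' : c ≤ d) : a * c ≤ b * d := by
  have h1 : a * c ≤ b * c :=
    (le_rdiv_iff a c _).1 (h.trans ((le_rdiv_iff b c _).2 le_rfl))
  exact h1.trans ((le_ldiv_iff b c _).1 (h'.trans ((le_ldiv_iff b d _).2 le_rfl)))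

theorem mul_ldiv_le (x z : α) : x * ldiv x z ≤ z := (le_ldiv_iff _ _ _).1 le_rfl

theorem rdiv_mul_le (y z : α) : rdiv z y * y ≤ z := (le_rdiv_iff _ _ _).1 le_rfl

theorem ldiv_mul (x y z : α) : ldiv (x * y) z = ldiv y (ldiv x z) :=
  eq_of_forall_le_iff fun w => by simp only [le_ldiv_iff, mul_assoc]

theorem rdiv_mul (x y z : α) : rdiv z (x * y) = rdiv (rdiv z y) x :=
  eq_of_forall_le_iff fun w => by simp only [le_rdiv_iff, mul_assoc]

theorem ldiv_rdiv (x y z : α) : ldiv x (rdiv z y) = rdiv (ldiv x z) y :=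
  eq_of_forall_le_iff fun w => by simp only [le_rdiv_iff, le_ldiv_iff, mul_assoc]

theorem one_ldiv (z : α) : ldiv 1 z = z :=
  eq_of_forall_le_iff fun w => by simp only [le_ldiv_iff, one_mul]

theorem rdiv_one (z : α) : rdiv z 1 = z :=
  eq_of_forall_le_iff fun w => by simp only [le_rdiv_iff, mul_one]

theorem ldiv_unit [IsIntegralRL α] (x : α) : ldiv x 1 = 1 :=
  le_antisymm (IsIntegralRL.le_unit _) ((le_ldiv_iff _ _ _).2 (IsIntegralRL.le_unit _))

theorem unit_rdiv [IsIntegralRL α] (x : α) : rdiv 1 x = 1 :=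
  le_antisymm (IsIntegralRL.le_unit _) ((le_rdiv_iff _ _ _).2 (IsIntegralRL.le_unit _))

end ResiduatedLattice

namespace RLNucleus

open ResiduatedLattice

variable {α : Type*} [ResiduatedLattice α] (δ : RLNucleus α)

theorem le_self (x : α) : x ≤ δ x := δ.le_closure' x

theorem idem (x : α) : δ (δ x) = δ x := δ.idempotent' x

theorem mono {x y : α} (h : x ≤ y) : δ x ≤ δ y := δ.monotone' h

theorem mul_le (x y : α) : δ x * δ y ≤ δ (x * y) := δ.mul_le' x y

theorem closed_unit [IsIntegralRL α] : δ 1 = 1 :=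
  le_antisymm (IsIntegralRL.le_unit _) (δ.le_self 1)

theorem closed_iff_le {x : α} : δ x = x ↔ δ x ≤ x :=
  ⟨fun h => h.le, fun h => le_antisymm h (δ.le_self x)⟩

theorem le_iff {x b : α} (hb : δ b = b) : δ x ≤ b ↔ x ≤ b :=
  ⟨(δ.le_self x).trans, fun h => (δ.mono h).trans hb.le⟩

theorem closed_inf {a b : α} (ha : δ a = a) (hb : δ b = b) : δ (a ⊓ b) = a ⊓ b :=
  δ.closed_iff_le.2 (le_inf ((δ.le_iff ha).2 inf_le_left) ((δ.le_iff hb).2 inf_le_right))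

theorem closed_rdiv (a : α) {b : α} (hb : δ b = b) : δ (rdiv b a) = rdiv b a := by
  refine δ.closed_iff_le.2 ((le_rdiv_iff _ _ _).2 ?_)
  refine (mul_mono le_rfl (δ.le_self a)).trans ((δ.mul_le _ _).trans ?_)
  exact (δ.le_iff hb).2 (rdiv_mul_le _ _)

theorem closed_ldiv (a : α) {b : α} (hb : δ b = b) : δ (ldiv a b) = ldiv a b := by
  refine δ.closed_iff_le.2 ((le_ldiv_iff _ _ _).2 ?_)
  refine (mul_mono (δ.le_self a) le_rfl).trans ((δ.mul_le _ _).trans ?_)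
  exact (δ.le_iff hb).2 (mul_ldiv_le _ _)

end RLNucleus

/-! ### Generalized `n`-rotations -/

/-- The universe of the generalized `n`-rotation of `α` with respect to the nucleus `δ`: the
elements `a` of `α`, the elements `ℓ i` with `0 < i < n - 1`, and a copy `b'` of each element `b`
of the nuclear image (the image of `δ` is the set of its fixed points). -/
inductive Rotation {α : Type*} [ResiduatedLattice α] (δ : RLNucleus α) (n : ℕ)
  | up (a : α)
  | mid (i : ℕ) (hi : 0 < i ∧ i + 1 < n)
  | down (b : α) (hb : δ b = b)

namespace Rotation

open ResiduatedLattice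

section

variable {α : Type*} [ResiduatedLattice α] {δ : RLNucleus α} {n : ℕ}

/-- The order: the dual of the nuclear image, below the `ℓ i`, below `α`. -/
protected def le : Rotation δ n → Rotation δ n → Prop
  | up a, up b => a ≤ b
  | up _, mid _ _ => False
  | up _, down _ _ => False
  | mid _ _, up _ => True
  | mid i _, mid j _ => i ≤ j
  | mid _ _, down _ _ => False
  | down _ _, up _ => True
  | down _ _, mid _ _ => True
  | down a _, down b _ => b ≤ a

/-- The meet. -/
protected def inf : Rotation δ n → Rotation δ n → Rotation δ n
  | up a, up b => up (a ⊓ b)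
  | up _, mid j hj => mid j hj
  | up _, down b hb => down b hb
  | mid i hi, up _ => mid i hi
  | mid i hi, mid j hj => mid (min i j) (by omega)
  | mid _ _, down b hb => down b hb
  | down a ha, up _ => down a ha
  | down a ha, mid _ _ => down a ha
  | down a _, down b _ => down (δ (a ⊔ b)) (δ.idem _)

/-- The join. -/
protected def sup : Rotation δ n → Rotation δ n → Rotation δ n
  | up a, up b => up (a ⊔ b)
  | up a, mid _ _ => up a
  | up a, down _ _ => up a
  | mid _ _, up b => up b
  | mid i hi, mid j hj => mid (max i j) (by omega)
  | mid i hi, down _ _ => mid i hi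
  | down _ _, up b => up b
  | down _ _, mid j hj => mid j hj
  | down a ha, down b hb => down (a ⊓ b) (δ.closed_inf ha hb)

instance : Lattice (Rotation δ n) where
  le := Rotation.le
  le_refl x := by cases x <;> simp [Rotation.le]
  le_trans x y z := by
    cases x <;> cases y <;> cases z <;> simp only [Rotation.le] <;>
      first
      | exact fun h h' => le_trans h h'
      | exact fun h h' => le_trans h' h
      | simp
  le_antisymm x y := by
    cases x <;> cases y <;> simp only [Rotation.le] <;> intro h h' <;>
      first
      | exact h.elim
      | exact h'.elim
      | (congr 1; exact le_antisymm h h')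
      | (congr 1; exact le_antisymm h' h)
  inf := Rotation.inf
  inf_le_left x y := by
    cases x <;> cases y <;> simp [Rotation.le, Rotation.inf]
    exact le_sup_left.trans (δ.le_self _)
  inf_le_right x y := by
    cases x <;> cases y <;> simp [Rotation.le, Rotation.inf]
    exact le_sup_right.trans (δ.le_self _)
  le_inf x y z := by
    rcases x with x | ⟨x, hx⟩ | ⟨x, hx⟩ <;> cases y <;> cases z <;>
      simp +contextual [Rotation.le, Rotation.inf]
    intro h h'
    exact (δ.le_iff hx).2 (sup_le h h')
  sup := Rotation.sup
  le_sup_left x y := by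
    cases x <;> cases y <;> simp [Rotation.le, Rotation.sup]
  le_sup_right x y := by
    cases x <;> cases y <;> simp [Rotation.le, Rotation.sup]
  sup_le x y z := by
    cases x <;> cases y <;> cases z <;> simp +contextual [Rotation.le, Rotation.sup]

/-- The left division `x \ y`. -/
protected def ldiv : Rotation δ n → Rotation δ n → Rotation δ n
  | up a, up b => up (ResiduatedLattice.ldiv a b)
  | up _, mid j hj => mid j hj
  | up a, down b _ => down (δ (b * a)) (δ.idem _)
  | mid _ _, up _ => up 1
  | mid i hi, mid j hj => if h : i ≤ j then up 1 else mid (n - 1 - i + j) (by omega)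
  | mid i hi, down _ _ => mid (n - 1 - i) (by omega)
  | down _ _, up _ => up 1
  | down _ _, mid _ _ => up 1
  | down a _, down b _ => up (ResiduatedLattice.rdiv a b)

/-- The right division `y / x`. -/
protected def rdiv : Rotation δ n → Rotation δ n → Rotation δ n
  | up b, up a => up (ResiduatedLattice.rdiv b a)
  | mid j hj, up _ => mid j hj
  | down b _, up a => down (δ (a * b)) (δ.idem _)
  | up _, mid _ _ => up 1
  | mid j hj, mid i hi => if h : i ≤ j then up 1 else mid (n - 1 - i + j) (by omega)
  | down _ _, mid i hi => mid (n - 1 - i) (by omega)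
  | up _, down _ _ => up 1
  | mid _ _, down _ _ => up 1
  | down b _, down a _ => up (ResiduatedLattice.ldiv b a)

end

section

variable {α : Type*} [ResiduatedLattice α] [IsIntegralRL α] {δ : RLNucleus α} {n : ℕ}

/-- The bottom element `0 = 1'`. -/
protected def zero : Rotation δ n := down 1 δ.closed_unit

/-- The product; on the elements `ℓ i` it is the product of the `n`-element MV-chain. -/
protected def mul : Rotation δ n → Rotation δ n → Rotation δ n
  | up a, up b => up (a * b)
  | up _, mid j hj => mid j hj
  | up a, down b hb => down (ResiduatedLattice.rdiv b a) (δ.closed_rdiv a hb)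
  | mid i hi, up _ => mid i hi
  | mid i hi, mid j hj => if h : n ≤ i + j then mid (i + j + 1 - n) (by omega) else Rotation.zero
  | mid _ _, down _ _ => Rotation.zero
  | down b hb, up a => down (ResiduatedLattice.ldiv a b) (δ.closed_ldiv a hb)
  | down _ _, mid _ _ => Rotation.zero
  | down _ _, down _ _ => Rotation.zero

/-- The generalized `n`-rotation of an integral residuated lattice is a residuated lattice. -/
instance : ResiduatedLattice (Rotation δ n) where
  mul := Rotation.mul
  one := up 1
  mul_assoc x y z := by
    change Rotation.mul (Rotation.mul x y) z = Rotation.mul x (Rotation.mul y z)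
    rcases x with x | ⟨x, hx⟩ | ⟨x, hx⟩ <;> rcases y with y | ⟨y, hy⟩ | ⟨y, hy⟩ <;>
      rcases z with z | ⟨z, hz⟩ | ⟨z, hz⟩ <;>
      simp only [Rotation.mul, Rotation.zero, mul_assoc, ldiv_mul, rdiv_mul, ldiv_rdiv,
        ldiv_unit, unit_rdiv] <;>
      (try split_ifs) <;> (try simp only [ldiv_unit, unit_rdiv]) <;> (try split_ifs) <;>
      first
      | rfl
      | omega
      | (congr 1; omega)
  one_mul x := by
    change Rotation.mul (up 1) x = x
    cases x <;> simp [Rotation.mul, rdiv_one]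
  mul_one x := by
    change Rotation.mul x (up 1) = x
    cases x <;> simp [Rotation.mul, one_ldiv]
  ldiv := Rotation.ldiv
  rdiv := Rotation.rdiv
  le_ldiv_iff x y z := by
    change Rotation.le y (Rotation.ldiv x z) ↔ Rotation.le (Rotation.mul x y) z
    rcases x with x | ⟨x, hx⟩ | ⟨x, hx⟩ <;> rcases y with y | ⟨y, hy⟩ | ⟨y, hy⟩ <;>
      rcases z with z | ⟨z, hz⟩ | ⟨z, hz⟩ <;>
      simp only [Rotation.ldiv, Rotation.mul, Rotation.zero] <;>
      (try split_ifs) <;>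
      simp only [Rotation.le, IsIntegralRL.le_unit, iff_true, iff_false, true_iff, false_iff] <;>
      first
      | exact ResiduatedLattice.le_ldiv_iff _ _ _
      | omega
      | rw [δ.le_iff hy, ResiduatedLattice.le_rdiv_iff]
      | rw [ResiduatedLattice.le_rdiv_iff, ResiduatedLattice.le_ldiv_iff]
  le_rdiv_iff x y z := by
    change Rotation.le x (Rotation.rdiv z y) ↔ Rotation.le (Rotation.mul x y) z
    rcases x with x | ⟨x, hx⟩ | ⟨x, hx⟩ <;> rcases y with y | ⟨y, hy⟩ | ⟨y, hy⟩ <;>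
      rcases z with z | ⟨z, hz⟩ | ⟨z, hz⟩ <;>
      simp only [Rotation.rdiv, Rotation.mul, Rotation.zero] <;>
      (try split_ifs) <;>
      simp only [Rotation.le, IsIntegralRL.le_unit, iff_true, iff_false, true_iff, false_iff] <;>
      first
      | exact ResiduatedLattice.le_rdiv_iff _ _ _
      | omega
      | rw [δ.le_iff hx, ResiduatedLattice.le_ldiv_iff]
      | rw [ResiduatedLattice.le_ldiv_iff, ResiduatedLattice.le_rdiv_iff]

end

section

variable {α β : Type*} [ResiduatedLattice α] [ResiduatedLattice β] {δ : RLNucleus α}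
  {ε : RLNucleus β}

/-- The map between generalized `n`-rotations induced by a map that commutes with the nuclei: it is
`f` on `α`, the identity on the elements `ℓ i`, and sends `b'` to `(f b)'`. -/
def map (f : α → β) (hf : ∀ a, ε (f a) = f (δ a)) (n : ℕ) : Rotation δ n → Rotation ε n
  | up a => up (f a)
  | mid i hi => mid i hi
  | down b hb => down (f b) ((hf b).trans (congrArg f hb))

end

end Rotation

/-! ### The algebras of the V-formation -/

/-- The universe of the three-element chain `u < v < 1`. -/
inductive VSA
  | e | v | u
  deriving DecidableEq

/-- The universe of the four-element chain `u < b < v < 1`. -/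
inductive VSB
  | e | v | b | u
  deriving DecidableEq

/-- The universe of the five-element chain `u < d < c < v < 1`. -/
inductive VSC
  | e | v | c | d | u
  deriving DecidableEq

namespace VSA

instance : Fintype VSA := ⟨{.e, .v, .u}, fun x => by cases x <;> decide⟩

/-- Height in the chain. -/
def rank : VSA → ℕ
  | u => 0 | v => 1 | e => 2

instance : LinearOrder VSA := LinearOrder.lift' rank (by unfold Function.Injective; decide)

/-- The product: the meet. -/
protected def mul : VSA → VSA → VSA
  | e, y => y
  | x, e => x
  | v, v => v
  | _, _ => u

/-- The division `x → y`. -/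
protected def imp : VSA → VSA → VSA
  | e, y => y
  | v, u => u
  | _, _ => e

/-- The three-element Gödel chain, with unit `e`. -/
instance : ResiduatedLattice VSA where
  mul := VSA.mul
  one := e
  mul_assoc := by decide
  one_mul := by decide
  mul_one := by decide
  ldiv := VSA.imp
  rdiv y x := VSA.imp x y
  le_ldiv_iff := by decide
  le_rdiv_iff := by decide

instance : IsIntegralRL VSA := ⟨by decide⟩

end VSA

namespace VSB

instance : Fintype VSB := ⟨{.e, .v, .b, .u}, fun x => by cases x <;> decide⟩

/-- Height in the chain. -/
def rank : VSB → ℕ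
  | u => 0 | b => 1 | v => 2 | e => 3

instance : LinearOrder VSB := LinearOrder.lift' rank (by unfold Function.Injective; decide)

/-- The product: `v * v = v`, `v * b = b`, `b * b = u`, and `u` is absorbing. -/
protected def mul : VSB → VSB → VSB
  | e, y => y
  | x, e => x
  | v, v => v
  | v, b => b
  | b, v => b
  | _, _ => u

/-- The division `x → y`: the nontrivial values are `v → b = b`, `v → u = u`, `b → u = b`. -/
protected def imp : VSB → VSB → VSB
  | e, y => y
  | v, b => b
  | v, u => u
  | b, u => b
  | _, _ => e

/-- The ordinal sum of the three-element MV-chain `{1, b, u}` with the two-element chain `{1, v}` on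
top, with unit `e`. -/
instance : ResiduatedLattice VSB where
  mul := VSB.mul
  one := e
  mul_assoc := by decide
  one_mul := by decide
  mul_one := by decide
  ldiv := VSB.imp
  rdiv y x := VSB.imp x y
  le_ldiv_iff := by decide
  le_rdiv_iff := by decide

instance : IsIntegralRL VSB := ⟨by decide⟩

end VSB

namespace VSC

instance : Fintype VSC := ⟨{.e, .v, .c, .d, .u}, fun x => by cases x <;> decide⟩

/-- Height in the chain. -/
def rank : VSC → ℕ
  | u => 0 | d => 1 | c => 2 | v => 3 | e => 4

instance : LinearOrder VSC := LinearOrder.lift' rank (by unfold Function.Injective; decide)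

/-- The product: `v * v = v`, `v * c = v * d = d`, all products of elements of `{c, d}` are `u`, and
`u` is absorbing. -/
protected def mul : VSC → VSC → VSC
  | e, y => y
  | x, e => x
  | v, v => v
  | v, c => d
  | v, d => d
  | c, v => d
  | d, v => d
  | _, _ => u

/-- The division `x → y`: the nontrivial values are `v → c = v → d = c`, `v → u = u`, `c → d = v`,
`c → u = d → u = c`. -/
protected def imp : VSC → VSC → VSC
  | e, y => y
  | v, c => c
  | v, d => c
  | v, u => u
  | c, d => v
  | c, u => c
  | d, u => c
  | _, _ => e

/-- The partial gluing of `{1, c, d, u}` with the two-element chain `{1, v}` on top, with unit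
`e`. -/
instance : ResiduatedLattice VSC where
  mul := VSC.mul
  one := e
  mul_assoc := by decide
  one_mul := by decide
  mul_one := by decide
  ldiv := VSC.imp
  rdiv y x := VSC.imp x y
  le_ldiv_iff := by decide
  le_rdiv_iff := by decide

instance : IsIntegralRL VSC := ⟨by decide⟩

end VSC

/-- The inclusion of the first algebra in the second. -/
def VSA.toVSB : VSA → VSB
  | e => .e | v => .v | u => .u

/-- The inclusion of the first algebra in the third. -/
def VSA.toVSC : VSA → VSC
  | e => .e | v => .v | u => .u

/-!
The obstruction is a single pair of elements. Suppose `h` and `k` map `VSB` and `VSC` to the same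
chain and agree on `v` and `u`. The element `b` satisfies `v * b = b` and `b \ u = b`, while
`v * c = v * d = d` and `c \ u = d \ u = c`. If `k c ≤ h b`, then dividing `u` gives
`h b = h b \ k u ≤ k c \ k u = k c`. If `h b ≤ k c`, then multiplying by `v` gives `h b ≤ k d`, and
dividing `u` gives `k c = k d \ k u ≤ h b \ k u = h b`. So `h b = k c`, and multiplication by `v`
turns this into `k c = k d` (`map_c_eq_map_d`).

Every integral residuated lattice embeds in its rotations by `Rotation.up`, so the same collapse
occurs for the rotations, and `k` cannot be injective. In a semilinear variety an amalgam is a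
subdirect product of chains. The collapse occurs in each factor, hence in the amalgam itself, which
refutes the amalgamation property; no single factor has to contain a copy of the third algebra.
Since that property quantifies over algebras of the universe `u`, it is applied to the copies of the
rotations in that universe (`ULift`).
-/

/-! ### Homomorphisms of residuated lattices -/

theorem IsRLHom.comp {α β γ : Type*} [ResiduatedLattice α] [ResiduatedLattice β]
    [ResiduatedLattice γ] {g : β → γ} {f : α → β} (hg : IsRLHom g) (hf : IsRLHom f) :
    IsRLHom (g ∘ f) where
  map_inf x y := by simp only [Function.comp, hf.map_inf, hg.map_inf]
  map_sup x y := by simp only [Function.comp, hf.map_sup, hg.map_sup]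
  map_mul x y := by simp only [Function.comp, hf.map_mul, hg.map_mul]
  map_ldiv x y := by simp only [Function.comp, hf.map_ldiv, hg.map_ldiv]
  map_rdiv x y := by simp only [Function.comp, hf.map_rdiv, hg.map_rdiv]
  map_one := by simp only [Function.comp, hf.map_one, hg.map_one]

theorem IsRLEmbedding.comp {α β γ : Type*} [ResiduatedLattice α] [ResiduatedLattice β]
    [ResiduatedLattice γ] {g : β → γ} {f : α → β} (hg : IsRLEmbedding g) (hf : IsRLEmbedding f) :
    IsRLEmbedding (g ∘ f) :=
  ⟨hg.toIsRLHom.comp hf.toIsRLHom, hg.injective.comp hf.injective⟩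

theorem IsRLHom.map_eval {α β : Type*} [ResiduatedLattice α] [ResiduatedLattice β] {f : α → β}
    (hf : IsRLHom f) (v : ℕ → α) (t : RLTerm) : f (t.eval v) = t.eval (f ∘ v) := by
  induction t with
  | var k => rfl
  | one => exact hf.map_one
  | inf s t hs ht => simp only [RLTerm.eval, hf.map_inf, hs, ht]
  | sup s t hs ht => simp only [RLTerm.eval, hf.map_sup, hs, ht]
  | mul s t hs ht => simp only [RLTerm.eval, hf.map_mul, hs, ht]
  | ldiv s t hs ht => simp only [RLTerm.eval, hf.map_ldiv, hs, ht]
  | rdiv s t hs ht => simp only [RLTerm.eval, hf.map_rdiv, hs, ht]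

theorem RLVariety.Mem.of_embedding {V : RLVariety} {α β : Type*} [ResiduatedLattice α]
    [ResiduatedLattice β] (hV : V.Mem β) {f : α → β} (hf : IsRLEmbedding f) : V.Mem α :=
  fun e he v => hf.injective <| by
    rw [hf.toIsRLHom.map_eval, hf.toIsRLHom.map_eval]
    exact hV e he _

theorem ResiduatedLattice.ldiv_anti_left {α : Type*} [ResiduatedLattice α] {x y : α} (h : x ≤ y)
    (z : α) : ResiduatedLattice.ldiv y z ≤ ResiduatedLattice.ldiv x z :=
  (le_ldiv_iff _ _ _).2 ((mul_mono h le_rfl).trans (mul_ldiv_le y z))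

/-! ### Change of universe -/

namespace ULift

/-- The copy of a residuated lattice in a larger universe. -/
instance instResiduatedLattice {α : Type*} [ResiduatedLattice α] :
    ResiduatedLattice (ULift.{u} α) where
  __ := (inferInstance : PartialOrder (ULift.{u} α))
  __ := (inferInstance : Monoid (ULift.{u} α))
  inf x y := ⟨x.down ⊓ y.down⟩
  inf_le_left x _ := inf_le_left (a := x.down)
  inf_le_right x _ := inf_le_right (a := x.down)
  le_inf _ _ _ h h' := le_inf (α := α) h h'
  sup x y := ⟨x.down ⊔ y.down⟩
  le_sup_left x _ := le_sup_left (a := x.down)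
  le_sup_right x _ := le_sup_right (a := x.down)
  sup_le _ _ _ h h' := sup_le (α := α) h h'
  ldiv x y := ⟨ResiduatedLattice.ldiv x.down y.down⟩
  rdiv x y := ⟨ResiduatedLattice.rdiv x.down y.down⟩
  le_ldiv_iff x y z := ResiduatedLattice.le_ldiv_iff x.down y.down z.down
  le_rdiv_iff x y z := ResiduatedLattice.le_rdiv_iff x.down y.down z.down

theorem isRLEmbedding_down {α : Type*} [ResiduatedLattice α] :
    IsRLEmbedding (ULift.down : ULift.{u} α → α) where
  map_inf _ _ := rfl
  map_sup _ _ := rfl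
  map_mul _ _ := rfl
  map_ldiv _ _ := rfl
  map_rdiv _ _ := rfl
  map_one := rfl
  injective := ULift.down_injective

theorem isRLEmbedding_up {α : Type*} [ResiduatedLattice α] :
    IsRLEmbedding (ULift.up : α → ULift.{u} α) where
  map_inf _ _ := rfl
  map_sup _ _ := rfl
  map_mul _ _ := rfl
  map_ldiv _ _ := rfl
  map_rdiv _ _ := rfl
  map_one := rfl
  injective := ULift.up_injective

end ULift

/-! ### Functoriality of the rotation -/

namespace Rotation

theorem isRLEmbedding_up {α : Type*} [ResiduatedLattice α] [IsIntegralRL α] (δ : RLNucleus α)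
    (n : ℕ) : IsRLEmbedding (up : α → Rotation δ n) where
  map_inf _ _ := rfl
  map_sup _ _ := rfl
  map_mul _ _ := rfl
  map_ldiv _ _ := rfl
  map_rdiv _ _ := rfl
  map_one := rfl
  injective _ _ h := up.inj h

theorem down_congr {α : Type*} [ResiduatedLattice α] {δ : RLNucleus α} {n : ℕ} {a b : α}
    (h : a = b) (ha : δ a = a) (hb : δ b = b) : (down a ha : Rotation δ n) = down b hb := by
  subst h; rfl

/-- The rotation is functorial for the embeddings that commute with the nuclei. -/
theorem isRLEmbedding_map {α β : Type*} [ResiduatedLattice α] [ResiduatedLattice β]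
    [IsIntegralRL α] [IsIntegralRL β] {δ : RLNucleus α} {ε : RLNucleus β} {f : α → β}
    (h : IsRLEmbedding f) (hf : ∀ a, ε (f a) = f (δ a)) (n : ℕ) :
    IsRLEmbedding (map (δ := δ) (ε := ε) f hf n) where
  map_inf x y := by
    rcases x with x | x | x <;> rcases y with y | y | y <;> first
      | rfl
      | exact congrArg up (h.map_inf _ _)
      | exact down_congr (by rw [← hf, h.map_sup]) _ _
  map_sup x y := by
    rcases x with x | x | x <;> rcases y with y | y | y <;> first
      | rfl
      | exact congrArg up (h.map_sup _ _)
      | exact down_congr (h.map_inf _ _) _ _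
  map_mul x y := by
    have h0 : map f hf n Rotation.zero = (Rotation.zero : Rotation ε n) :=
      down_congr h.map_one _ _
    change map f hf n (Rotation.mul x y) = Rotation.mul (map f hf n x) (map f hf n y)
    rcases x with x | x | x <;> rcases y with y | y | y <;> first
      | rfl
      | exact h0
      | exact congrArg up (h.map_mul _ _)
      | exact down_congr (h.map_rdiv _ _) _ _
      | exact down_congr (h.map_ldiv _ _) _ _
      | (simp only [map, Rotation.mul]; split_ifs <;> first | rfl | exact h0)
  map_ldiv x y := by
    have h1 : map f hf n (up 1) = up 1 := congrArg up h.map_one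
    change map f hf n (Rotation.ldiv x y) = Rotation.ldiv (map f hf n x) (map f hf n y)
    rcases x with x | x | x <;> rcases y with y | y | y <;> first
      | rfl
      | exact h1
      | exact congrArg up (h.map_ldiv _ _)
      | exact congrArg up (h.map_rdiv _ _)
      | exact down_congr (by rw [← hf, h.map_mul]) _ _
      | (simp only [map, Rotation.ldiv]; split_ifs <;> first | rfl | exact h1)
  map_rdiv x y := by
    have h1 : map f hf n (up 1) = up 1 := congrArg up h.map_one
    change map f hf n (Rotation.rdiv x y) = Rotation.rdiv (map f hf n x) (map f hf n y)
    rcases x with x | x | x <;> rcases y with y | y | y <;> first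
      | rfl
      | exact h1
      | exact congrArg up (h.map_rdiv _ _)
      | exact congrArg up (h.map_ldiv _ _)
      | exact down_congr (by rw [← hf, h.map_mul]) _ _
      | (simp only [map, Rotation.rdiv]; split_ifs <;> first | rfl | exact h1)
  map_one := congrArg up h.map_one
  injective x y hxy := by
    rcases x with x | x | x <;> rcases y with y | y | y <;> simp only [map, reduceCtorEq] at hxy
    · exact congrArg up (h.injective (up.inj hxy))
    · simpa using hxy
    · exact down_congr (h.injective (down.inj hxy)) _ _

end Rotation

/-! ### The obstruction in a chain -/

theorem VSA.isRLEmbedding_toVSB : IsRLEmbedding VSA.toVSB where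
  map_inf := by decide
  map_sup := by decide
  map_mul := by decide
  map_ldiv := by decide
  map_rdiv := by decide
  map_one := rfl
  injective := by unfold Function.Injective; decide

theorem VSA.isRLEmbedding_toVSC : IsRLEmbedding VSA.toVSC where
  map_inf := by decide
  map_sup := by decide
  map_mul := by decide
  map_ldiv := by decide
  map_rdiv := by decide
  map_one := rfl
  injective := by unfold Function.Injective; decide

/-- Homomorphisms of `VSB` and `VSC` to a chain that agree on `v` and `u` identify `c` and `d`. -/
theorem map_c_eq_map_d {D : Type*} [ResiduatedLattice D] (hD : IsRLChain D) {h : VSB → D}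
    {k : VSC → D} (hh : IsRLHom h) (hk : IsRLHom k) (hv : h .v = k .v) (hu : h .u = k .u) :
    k .c = k .d := by
  have vb : k .v * h .b = h .b := by rw [← hv, ← hh.map_mul]; rfl
  have bu : ResiduatedLattice.ldiv (h .b) (k .u) = h .b := by rw [← hu, ← hh.map_ldiv]; rfl
  have vc : k .v * k .c = k .d := (hk.map_mul .v .c).symm
  have cu : ResiduatedLattice.ldiv (k .c) (k .u) = k .c := (hk.map_ldiv .c .u).symm
  have du : ResiduatedLattice.ldiv (k .d) (k .u) = k .c := (hk.map_ldiv .d .u).symm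
  have key : h .b = k .c := by
    rcases hD (h .b) (k .c) with hbc | hcb
    · have hbd : h .b ≤ k .d := by
        rw [← vb, ← vc]
        exact ResiduatedLattice.mul_mono le_rfl hbc
      refine le_antisymm hbc ?_
      rw [← du, ← bu]
      exact ResiduatedLattice.ldiv_anti_left hbd _
    · refine le_antisymm ?_ hcb
      rw [← bu, ← cu]
      exact ResiduatedLattice.ldiv_anti_left hcb _
  rw [← vc, ← key, vb]

/-- The collapse for rotations: if homomorphisms of the rotations of `VSB` and `VSC` to a chain
agree on the rotation of `VSA`, then they identify `c` and `d`. -/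
theorem Rotation.map_up_c_eq_map_up_d {n : ℕ} {δA : RLNucleus VSA} {δB : RLNucleus VSB}
    {δC : RLNucleus VSC} {hB : ∀ a, δB a.toVSB = (δA a).toVSB}
    {hC : ∀ a, δC a.toVSC = (δA a).toVSC} {D : Type*} [ResiduatedLattice D] (hD : IsRLChain D)
    {h : Rotation δB n → D} {k : Rotation δC n → D} (hh : IsRLHom h) (hk : IsRLHom k)
    (hhk : h ∘ Rotation.map (δ := δA) VSA.toVSB hB n = k ∘ Rotation.map VSA.toVSC hC n) :
    k (up .c) = k (up .d) :=
  map_c_eq_map_d hD (hh.comp (isRLEmbedding_up δB n).toIsRLHom)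
    (hk.comp (isRLEmbedding_up δC n).toIsRLHom) (congrFun hhk (up .v)) (congrFun hhk (up .u))

theorem mainTheorem4 (n : ℕ) (hn : 2 ≤ n)
    (δA : RLNucleus VSA) (δB : RLNucleus VSB) (δC : RLNucleus VSC)
    (hB : ∀ a, δB a.toVSB = (δA a).toVSB) (hC : ∀ a, δC a.toVSC = (δA a).toVSC) :
    IsVFormation (Rotation.map (δ := δA) (ε := δB) VSA.toVSB hB n)
        (Rotation.map (δ := δA) (ε := δC) VSA.toVSC hC n) ∧
      (∀ (D : Type u) [ResiduatedLattice D], IsRLChain D →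
        (¬ ∃ (h : Rotation δB n → D) (k : Rotation δC n → D),
            IsAmalgam (Rotation.map (δ := δA) VSA.toVSB hB n) (Rotation.map VSA.toVSC hC n) h k) ∧
          ¬ ∃ (h : Rotation δB n → D) (k : Rotation δC n → D),
            IsOneAmalgam (Rotation.map (δ := δA) VSA.toVSB hB n)
              (Rotation.map VSA.toVSC hC n) h k) ∧
      ∀ V : RLVariety, V.Semilinear.{u} → V.CEP.{u} →
        V.Mem (Rotation δA n) → V.Mem (Rotation δB n) → V.Mem (Rotation δC n) →
          ¬ V.AP.{u} := by
  have embB := Rotation.isRLEmbedding_map VSA.isRLEmbedding_toVSB hB n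
  have embC := Rotation.isRLEmbedding_map VSA.isRLEmbedding_toVSC hC n
  have hcd : (Rotation.up .c : Rotation δC n) ≠ Rotation.up .d := by simp
  have noOne : ∀ (D : Type u) [ResiduatedLattice D], IsRLChain D →
      ¬ ∃ (h : Rotation δB n → D) (k : Rotation δC n → D),
        IsOneAmalgam (Rotation.map (δ := δA) VSA.toVSB hB n) (Rotation.map VSA.toVSC hC n) h k := by
    rintro D _ hD ⟨h, k, hh, hk, hhk⟩
    exact hcd (hk.injective (Rotation.map_up_c_eq_map_up_d hD hh hk.toIsRLHom hhk))
  refine ⟨⟨embB, embC⟩, fun D _ hD => ⟨?_, noOne D hD⟩, ?_⟩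
  · rintro ⟨h, k, hh, hk, hhk⟩
    exact noOne D hD ⟨h, k, hh.toIsRLHom, hk, hhk⟩
  · intro V hsl _ hA hB' hC' hAP
    obtain ⟨D, _, hVD, h, k, hh, hk, hhk⟩ :=
      hAP (ULift.{u} (Rotation δA n)) (ULift.{u} (Rotation δB n)) (ULift.{u} (Rotation δC n))
        (hA.of_embedding ULift.isRLEmbedding_down) (hB'.of_embedding ULift.isRLEmbedding_down)
        (hC'.of_embedding ULift.isRLEmbedding_down)
        (ULift.up ∘ Rotation.map VSA.toVSB hB n ∘ ULift.down)
        (ULift.up ∘ Rotation.map VSA.toVSC hC n ∘ ULift.down)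
        ⟨ULift.isRLEmbedding_up.comp (embB.comp ULift.isRLEmbedding_down),
          ULift.isRLEmbedding_up.comp (embC.comp ULift.isRLEmbedding_down)⟩
    obtain ⟨ι, F, _, p, hF, hp, hinj⟩ := hsl D hVD
    refine hcd (ULift.up_injective (hk.injective (hinj (funext fun i => ?_))))
    exact Rotation.map_up_c_eq_map_up_d (h := p i ∘ h ∘ ULift.up) (k := p i ∘ k ∘ ULift.up) (hF i)
      ((hp i).1.comp (hh.toIsRLHom.comp ULift.isRLEmbedding_up.toIsRLHom))
      ((hp i).1.comp (hk.toIsRLHom.comp ULift.isRLEmbedding_up.toIsRLHom))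
      (funext fun x => congrArg (p i) (congrFun hhk (ULift.up x)))
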